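/- There exist universal constants $C,c>0$ such that the following holds. Let $m,n,s$ be integers with $m\ge 0$ and $1\le s\le n$, let $0<\eta<1$ and $\theta>0$, and let $A$ be an $m\times n$ standard Gaussian random matrix (independent entries, each normally distributed with mean $0$ and variance $1$). Let $Q_\theta(z)=\big(\theta\lfloor z_i/\theta\rfloor+\theta/2\big)_{i=1}^m$ for $z\in\mathbb{R}^m$, and let $B_\theta=\{z\in\mathbb{R}^m : -\theta/2\le z_i<\theta/2,\ i=1,\dots,m\}$. Suppose that $$m\ \ge\ C\big(s\log(en/s)+\log(\eta^{-1})\big).$$ Then, with probability exceeding $1-\eta$, the following holds: for every $\hat x\in\mathbb{R}^n$ with quantized measurements $y=Q_\theta(A\hat x)$, every solution $x^{\#}$ of the program $$\min_{z\in\mathbb{R}^n}\|z\|_1\quad\text{subject to}\quad Az-y\in B_\theta$$ is quantization consistent, i.e. $y=Q_\theta(Ax^{\#})$, and satisfies $$\|\hat x-x^{\#}\|_2\ \le\ c\,\big(s^{-1/2}\sigma_s(\hat x)_1+\theta\big),$$ where $\sigma_s(\hat x)_1=\inf\{\|\hat x-z\|_1 : z\in\mathbb{R}^n \text{ has at most }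 s \text{ nonzero entries}\}$. -/

import Mathlib

open MeasureTheory ProbabilityTheory

namespace QuantizedCS

noncomputable section

/-- The `ℓ₁`-norm `∑ j, |x j|` on `ℝⁿ`. -/
def l1Norm {n : ℕ} (x : Fin n → ℝ) : ℝ := ∑ j, |x j|

/-- The Euclidean norm on `ℝⁿ`. -/
def l2Norm {n : ℕ} (x : Fin n → ℝ) : ℝ := Real.sqrt (∑ j, x j ^ 2)

/-- `σ_s(x)₁`, the error of best `s`-term approximation in `ℓ₁`: the infimum of `‖x - z‖₁`
over all `z` with at most `s` nonzero entries (`hammingNorm z` counts the nonzero entries). -/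
def bestTermError {n : ℕ} (s : ℕ) (x : Fin n → ℝ) : ℝ :=
  sInf ((fun z : Fin n → ℝ => l1Norm (x - z)) '' {z | hammingNorm z ≤ s})

/-- The uniform scalar quantizer `Q_θ` with bin width `θ`, applied entrywise. -/
def quantizer {m : ℕ} (θ : ℝ) (z : Fin m → ℝ) : Fin m → ℝ :=
  fun i => θ * (⌊z i / θ⌋ : ℝ) + θ / 2

/-- The half-open cube `B_θ = [-θ/2, θ/2)^m`. -/
def bin (m : ℕ) (θ : ℝ) : Set (Fin m → ℝ) :=
  {z | ∀ i, -(θ / 2) ≤ z i ∧ z i < θ / 2}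

/-- The feasible set of quantization consistent basis pursuit. -/
def feasible {m n : ℕ} (A : Matrix (Fin m) (Fin n) ℝ) (θ : ℝ) (y : Fin m → ℝ) :
    Set (Fin n → ℝ) :=
  {z | A.mulVec z - y ∈ bin m θ}

/-- `x` solves the program (QCBP): minimize `‖z‖₁` subject to `A z - y ∈ B_θ`. -/
def IsQCBPSolution {m n : ℕ} (A : Matrix (Fin m) (Fin n) ℝ) (θ : ℝ) (y : Fin m → ℝ)
    (x : Fin n → ℝ) : Prop :=
  x ∈ feasible A θ y ∧ ∀ z ∈ feasible A θ y, l1Norm x ≤ l1Norm z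

/-- `x` is consistent with the quantized measurements `y`, i.e. `y = Q_θ(A x)`. -/
def IsQuantizationConsistent {m n : ℕ} (A : Matrix (Fin m) (Fin n) ℝ) (θ : ℝ)
    (y : Fin m → ℝ) (x : Fin n → ℝ) : Prop :=
  y = quantizer θ (A.mulVec x)

/-- `A` is an `m × n` standard Gaussian random matrix on `(Ω, μ)`: its entries are independent
and each is normally distributed with mean zero and variance one. -/
structure IsStandardGaussianMatrix {Ω : Type*} [MeasurableSpace Ω] (μ : Measure Ω) {m n : ℕ}
    (A : Ω → Matrix (Fin m) (Fin n) ℝ) : Prop where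
  hasLaw : ∀ i j, HasLaw (fun ω => A ω i j) (gaussianReal 0 1) μ
  indep : iIndepFun (fun (ij : Fin m × Fin n) (ω : Ω) => A ω ij.1 ij.2) μ

end

end QuantizedCS

/-! ### Maurey's method and the transfer principle -/

namespace QuantizedCS

/-! Both `xhat` and a minimizer lie in the same quantization cell, so their difference `h` has `|(A
h) i| ≤ θ` for all `i`, hence `‖A h‖₂² ≤ m θ²`. Minimality in `ℓ₁` gives `‖h‖₁ ≤ 2√s ‖h‖₂ + 2σ_s`.
It remains to bound `‖A h‖₂` below on such effectively sparse vectors.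

No net or restricted isometry is used. Chi-square tails and a union bound give `(m/8)‖u‖₂² ≤ ‖A u‖₂²
≤ 4m‖u‖₂²` for all integer vectors `u` that are sums of at most `512s + 1` signed unit vectors.
Averaging the form `‖A u‖₂² - (m/8)‖u‖₂²` over random such sums with mean proportional to `h`
transfers the lower bound to every real `h`, with a loss of order `m‖h‖₁²/s`
(`sum_sq_mulVec_ge_sub_l1Norm_sq`). The cone bound lets half of the main term absorb the `‖h‖₂` part
of this loss. Consistency is just feasibility. -/

/-- Derandomized form of Maurey's empirical method. -/
theorem exists_combination_bilin_le {ι V : Type*} [Fintype ι] [DecidableEq ι] [AddCommGroup V]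
    [Module ℝ V] (B : LinearMap.BilinForm ℝ V) (v : ι → V) (p : ι → ℝ) (hp : ∀ i, 0 ≤ p i)
    (hp1 : ∑ i, p i = 1) {D : ℝ} (hD : ∀ i, B (v i) (v i) ≤ D) (k : ℕ) (u : V) :
    ∃ F : ι → ℕ, ∑ i, F i = k ∧
      B (u + ∑ i, (F i : ℝ) • v i) (u + ∑ i, (F i : ℝ) • v i) ≤
        B u u + k * (B u (∑ i, p i • v i) + B (∑ i, p i • v i) u)
          + k * (k - 1) * B (∑ i, p i • v i) (∑ i, p i • v i) + k * D := by
  set x := ∑ i, p i • v i with hx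
  induction k generalizing u with
  | zero => exact ⟨0, by simp, by simp⟩
  | succ k ih =>
    have hlin1 : ∀ w, ∑ i, p i * B w (v i) = B w x := fun w => by simp [hx, map_sum]
    have hlin2 : ∀ w, ∑ i, p i * B (v i) w = B x w := fun w => by
      simp [hx, map_sum, LinearMap.sum_apply]
    have hconst : ∀ a : ℝ, ∑ i, p i * a = a := fun a => by rw [← Finset.sum_mul, hp1, one_mul]
    -- Method of conditional expectations: the `p`-average of the left side is at most the right
    -- side, so some atom does no worse. `B` need not be positive.
    obtain ⟨i, hi, hle⟩ : ∃ i, 0 < p i ∧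
        B (u + v i) (u + v i) + k * (B (u + v i) x + B x (u + v i)) ≤
          B u u + B u x + B x u + D + k * (B u x + B x u + 2 * B x x) := by
      by_contra! hcon
      have hsum : ∑ i, p i * (B (u + v i) (u + v i) + k * (B (u + v i) x + B x (u + v i))) ≤
          B u u + B u x + B x u + D + k * (B u x + B x u + 2 * B x x) := by
        calc _ ≤ ∑ i, (p i * (B u u) + p i * B u (v i) + p i * B (v i) u + p i * D
              + k * (p i * B u x + p i * B (v i) x + p i * B x u + p i * B x (v i))) := by
              refine Finset.sum_le_sum fun i _ => ?_
              simp only [map_add, LinearMap.add_apply]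
              nlinarith [mul_le_mul_of_nonneg_left (hD i) (hp i)]
          _ = _ := by
              simp only [Finset.sum_add_distrib, ← Finset.mul_sum]
              simp only [hlin1, hlin2]
              simp only [← Finset.sum_mul, hp1]
              ring
      obtain ⟨j, hj⟩ : ∃ j, 0 < p j := by
        by_contra! h
        have : ∑ i, p i ≤ 0 := Finset.sum_nonpos fun i _ => h i
        linarith
      refine absurd hsum (not_le.2 ?_)
      rw [← hconst (B u u + B u x + B x u + D + k * (B u x + B x u + 2 * B x x))]
      refine Finset.sum_lt_sum (fun i _ => ?_) ⟨j, Finset.mem_univ _, ?_⟩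
      · rcases (hp i).eq_or_lt with h | h
        · simp [← h]
        · exact mul_le_mul_of_nonneg_left (hcon i h).le h.le
      · exact mul_lt_mul_of_pos_left (hcon j hj) hj
    obtain ⟨F, hF, hB⟩ := ih (u + v i)
    refine ⟨F + Pi.single i 1, ?_, ?_⟩
    · simp [Finset.sum_add_distrib, hF]
    · have : u + ∑ j, ((F + Pi.single i 1 : ι → ℕ) j : ℝ) • v j
          = u + v i + ∑ j, (F j : ℝ) • v j := by
        simp [add_smul, Finset.sum_add_distrib, Pi.single_apply]
        abel
      rw [this]
      push_cast
      nlinarith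

/-- The vector with integer entries obtained from multiplicities of the atoms `±eⱼ`. -/
def signedCount {n : ℕ} (F : Fin n × Bool → ℕ) : Fin n → ℝ :=
  fun j => (F (j, true) : ℝ) - F (j, false)

/-- The signed unit vectors `±eⱼ`. -/
noncomputable def signedUnit {n : ℕ} (i : Fin n × Bool) : Fin n → ℝ :=
  Pi.single i.1 (if i.2 then 1 else -1)

theorem sum_smul_signedUnit {n : ℕ} (c : Fin n × Bool → ℝ) :
    ∑ i, c i • signedUnit i = fun j => c (j, true) - c (j, false) := by
  ext j
  simp [Fintype.sum_prod_type, signedUnit, Finset.sum_apply, Pi.single_apply,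
    sub_eq_add_neg]

theorem signedCount_single {n : ℕ} (i : Fin n × Bool) :
    signedCount (Pi.single i 1) = signedUnit i := by
  have := sum_smul_signedUnit (fun j => ((Pi.single i 1 : Fin n × Bool → ℕ) j : ℝ))
  refine this.symm.trans ?_
  simp [Pi.single_apply]

theorem sum_sq_signedUnit {n : ℕ} (i : Fin n × Bool) : ∑ j, signedUnit i j ^ 2 = 1 := by
  rcases i with ⟨i, _ | _⟩ <;> simp [signedUnit, Pi.single_apply, ite_pow]

theorem l1Norm_nonneg {n : ℕ} (x : Fin n → ℝ) : 0 ≤ l1Norm x :=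
  Finset.sum_nonneg fun _ _ => abs_nonneg _

/-- Transfer principle: lower bounds for the integer vectors of `ℓ₁`-norm at most `N + 1` extend
to all vectors, up to an error governed by the `ℓ₁`-norm. -/
theorem sum_sq_mulVec_ge_sub_l1Norm_sq {m n : ℕ} (A : Matrix (Fin m) (Fin n) ℝ) {a b : ℝ}
    (ha : 0 ≤ a) {N : ℕ} (hN : 0 < N)
    (hA : ∀ F : Fin n × Bool → ℕ, ∑ i, F i ≤ N + 1 →
      a * ∑ j, signedCount F j ^ 2 ≤ ∑ i, A.mulVec (signedCount F) i ^ 2 ∧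
      ∑ i, A.mulVec (signedCount F) i ^ 2 ≤ b * ∑ j, signedCount F j ^ 2)
    (x : Fin n → ℝ) :
    a * ∑ j, x j ^ 2 - b * l1Norm x ^ 2 / N ≤ ∑ i, A.mulVec x i ^ 2 := by
  rcases (l1Norm_nonneg x).eq_or_lt with h0 | hW
  · have hx : x = 0 := by
      ext j
      have := (Finset.sum_eq_zero_iff_of_nonneg (fun j _ => abs_nonneg (x j))).1 h0.symm j
        (Finset.mem_univ j)
      simpa using this
    subst hx
    simp [l1Norm]
  set W := l1Norm x with hWdef
  let B : LinearMap.BilinForm ℝ (Fin n → ℝ) := Matrix.toBilin' (A.transpose * A - a • 1)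
  have hB : ∀ u, B u u = ∑ i, A.mulVec u i ^ 2 - a * ∑ j, u j ^ 2 := fun u => by
    have h : dotProduct u ((A.transpose * A).mulVec u) = dotProduct (A.mulVec u) (A.mulVec u) := by
      rw [← Matrix.mulVec_mulVec, Matrix.dotProduct_mulVec, Matrix.vecMul_transpose]
    simp only [B, Matrix.toBilin'_apply', Matrix.sub_mulVec, Matrix.smul_mulVec,
      Matrix.one_mulVec, dotProduct_sub, dotProduct_smul, h, smul_eq_mul]
    simp [dotProduct, sq]
  let p : Fin n × Bool → ℝ := fun i => (if i.2 then max (x i.1) 0 else max (-x i.1) 0) / W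
  have hp : ∀ i, 0 ≤ p i := fun i => by
    refine div_nonneg ?_ hW.le
    split_ifs <;> exact le_max_right _ _
  have hp1 : ∑ i, p i = 1 := by
    have : ∀ j, max (x j) 0 + max (-x j) 0 = |x j| := fun j => by
      rcases le_total 0 (x j) with h | h
      · rw [max_eq_left h, max_eq_right (by linarith), abs_of_nonneg h, add_zero]
      · rw [max_eq_right h, max_eq_left (by linarith), abs_of_nonpos h, zero_add]
    simp only [p, Fintype.sum_prod_type, Fintype.sum_bool, if_true, Bool.false_eq_true, if_false, ← add_div]
    simp only [this, ← Finset.sum_div]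
    exact div_self hW.ne'
  have hmean : ∑ i, p i • signedUnit i = W⁻¹ • x := by
    rw [sum_smul_signedUnit]
    ext j
    have : max (x j) 0 - max (-x j) 0 = x j := by
      rcases le_total 0 (x j) with h | h
      · rw [max_eq_left h, max_eq_right (by linarith), sub_zero]
      · rw [max_eq_right h, max_eq_left (by linarith)]; ring
    simp only [p, if_true, Bool.false_eq_true, if_false, ← sub_div, this, Pi.smul_apply,
      smul_eq_mul]
    ring
  have hD : ∀ i, B (signedUnit i) (signedUnit i) ≤ b := fun i => by
    have h := (hA (Pi.single i 1) (by simp [Finset.sum_pi_single'])).2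
    rw [signedCount_single, sum_sq_signedUnit] at h
    rw [hB, sum_sq_signedUnit]
    linarith
  -- With `N + 1` draws the weights are `(N + 1) * N` for the mean and `N + 1` for the diagonal;
  -- cancelling `N + 1` leaves exactly the factor `N`.
  obtain ⟨F, hF, hle⟩ := exists_combination_bilin_le B signedUnit p hp hp1 hD (N + 1) 0
  rw [hmean, sum_smul_signedUnit] at hle
  have hq := (hA F hF.le).1
  have hpos : 0 ≤ B (signedCount F) (signedCount F) := by rw [hB]; linarith
  have hN' : (0 : ℝ) < N := by exact_mod_cast hN
  have hle' : 0 ≤ (N + 1) * (N * (W⁻¹ * (W⁻¹ * B x x)) + b) := by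
    have h0 : B (signedCount F) (signedCount F) ≤
        ((N + 1 : ℕ) : ℝ) * ((N + 1 : ℕ) - 1) * B (W⁻¹ • x) (W⁻¹ • x) + ((N + 1 : ℕ) : ℝ) * b := by
      simp only [zero_add, map_zero, LinearMap.zero_apply, add_zero, mul_zero] at hle
      exact hle
    refine (hpos.trans h0).trans_eq ?_
    simp only [map_smul, LinearMap.smul_apply, smul_eq_mul]
    push_cast
    ring
  have h1 : 0 ≤ N * (W⁻¹ * (W⁻¹ * B x x)) + b := nonneg_of_mul_nonneg_right hle' (by positivity)
  have h2 : 0 ≤ B x x + b * W ^ 2 / N := by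
    have : B x x + b * W ^ 2 / N = (W ^ 2 / N) * (N * (W⁻¹ * (W⁻¹ * B x x)) + b) := by
      field_simp
    rw [this]; positivity
  rw [hB] at h2
  linarith

/-! ### Feasibility and deterministic recovery -/

theorem quantizationConsistent_of_mem_feasible {m n : ℕ} {A : Matrix (Fin m) (Fin n) ℝ} {θ : ℝ}
    (hθ : 0 < θ) {x z : Fin n → ℝ} (hz : z ∈ feasible A θ (quantizer θ (A.mulVec x))) :
    IsQuantizationConsistent A θ (quantizer θ (A.mulVec x)) z := by
  ext i
  have h := hz i
  simp only [Pi.sub_apply, quantizer] at h ⊢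
  have : ⌊A.mulVec z i / θ⌋ = ⌊A.mulVec x i / θ⌋ := by
    rw [Int.floor_eq_iff, le_div_iff₀ hθ, div_lt_iff₀ hθ]
    constructor <;> nlinarith [h.1, h.2]
  rw [this]

theorem self_mem_feasible {m n : ℕ} (A : Matrix (Fin m) (Fin n) ℝ) {θ : ℝ} (hθ : 0 < θ)
    (x : Fin n → ℝ) : x ∈ feasible A θ (quantizer θ (A.mulVec x)) := by
  intro i
  simp only [Pi.sub_apply, quantizer]
  have h1 := (le_div_iff₀ hθ).1 (Int.floor_le (A.mulVec x i / θ))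
  have h2 := (div_lt_iff₀ hθ).1 (Int.lt_floor_add_one (A.mulVec x i / θ))
  constructor <;> nlinarith

theorem abs_mulVec_sub_le_of_feasible {m n : ℕ} {A : Matrix (Fin m) (Fin n) ℝ} {θ : ℝ}
    {y : Fin m → ℝ} {x z : Fin n → ℝ} (hx : x ∈ feasible A θ y) (hz : z ∈ feasible A θ y)
    (i : Fin m) : |A.mulVec (x - z) i| ≤ θ := by
  have h1 := hx i
  have h2 := hz i
  simp only [Pi.sub_apply, Matrix.mulVec_sub] at *
  rw [abs_le]
  constructor <;> linarith

theorem l2Norm_sq {n : ℕ} (x : Fin n → ℝ) : l2Norm x ^ 2 = ∑ j, x j ^ 2 :=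
  Real.sq_sqrt (Finset.sum_nonneg fun _ _ => sq_nonneg _)

theorem l2Norm_nonneg {n : ℕ} (x : Fin n → ℝ) : 0 ≤ l2Norm x := Real.sqrt_nonneg _

theorem sum_abs_le_sqrt_mul_l2Norm {n s : ℕ} (h : Fin n → ℝ) {S : Finset (Fin n)}
    (hS : S.card ≤ s) : ∑ j ∈ S, |h j| ≤ √s * l2Norm h := by
  refine le_of_sq_le_sq ?_ (mul_nonneg (Real.sqrt_nonneg _) (l2Norm_nonneg h))
  rw [mul_pow, l2Norm_sq, Real.sq_sqrt (Nat.cast_nonneg s)]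
  calc (∑ j ∈ S, |h j|) ^ 2 ≤ S.card * ∑ j ∈ S, |h j| ^ 2 := sq_sum_le_card_mul_sum_sq
    _ ≤ s * ∑ j, h j ^ 2 := by
      simp only [sq_abs]
      gcongr
      exact Finset.subset_univ S

/-- The error of an `ℓ₁`-minimizer lies in the cone of effectively sparse vectors, up to the error
of best `s`-term approximation. -/
theorem l1Norm_sub_le_of_l1Norm_le {n s : ℕ} {x z : Fin n → ℝ} (hz : l1Norm z ≤ l1Norm x) :
    l1Norm (x - z) ≤ 2 * √s * l2Norm (x - z) + 2 * bestTermError s x := by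
  suffices (l1Norm (x - z) - 2 * √s * l2Norm (x - z)) / 2 ≤ bestTermError s x by linarith
  refine le_csInf ⟨_, Set.mem_image_of_mem _ (show (0 : Fin n → ℝ) ∈ _ by simp)⟩ ?_
  rintro _ ⟨w, hw, rfl⟩
  simp only [Set.mem_ofPred_eq, hammingNorm] at hw
  set S := Finset.univ.filter fun j => w j ≠ 0
  have hS := sum_abs_le_sqrt_mul_l2Norm (x - z) hw
  -- Off the support of `w`, `x j` equals `(x - w) j`, so the triangle inequality suffices; on it,
  -- the error is paid for twice.
  have hpt : ∀ j, |(x - z) j| ≤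
      |z j| - |x j| + 2 * (if w j ≠ 0 then |(x - z) j| else 0) + 2 * |(x - w) j| := fun j => by
    simp only [Pi.sub_apply]
    split_ifs with h
    · have h1 := abs_sub_abs_le_abs_sub (x j) (z j)
      have h2 := abs_nonneg (x j - w j)
      linarith
    · rw [not_not.1 h, sub_zero]
      have := abs_sub (x j) (z j)
      linarith
  have hsum := Finset.sum_le_sum fun j (_ : j ∈ Finset.univ) => hpt j
  simp only [Finset.sum_add_distrib, Finset.sum_sub_distrib, ← Finset.mul_sum,
    ← Finset.sum_filter] at hsum
  simp only [l1Norm] at *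
  linarith

/-- Deterministic recovery guarantee. -/
theorem l2Norm_sub_le {m n s : ℕ} (hm : 0 < m) (hs : 0 < s) {A : Matrix (Fin m) (Fin n) ℝ}
    (hA : ∀ F : Fin n × Bool → ℕ, ∑ i, F i ≤ 512 * s + 1 →
      (m / 8 : ℝ) * ∑ j, signedCount F j ^ 2 ≤ ∑ i, A.mulVec (signedCount F) i ^ 2 ∧
      ∑ i, A.mulVec (signedCount F) i ^ 2 ≤ (4 * m : ℝ) * ∑ j, signedCount F j ^ 2)
    {θ : ℝ} (hθ : 0 < θ) {x z : Fin n → ℝ} (hz : l1Norm z ≤ l1Norm x)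
    (hAxz : ∀ i, |A.mulVec (x - z) i| ≤ θ) :
    l2Norm (x - z) ≤ 4 * ((s : ℝ) ^ (-(1 / 2) : ℝ) * bestTermError s x + θ) := by
  have hlow := sum_sq_mulVec_ge_sub_l1Norm_sq A (by positivity) (by positivity) hA (x - z)
  have hup : ∑ i, A.mulVec (x - z) i ^ 2 ≤ m * θ ^ 2 := by
    calc _ ≤ ∑ _i : Fin m, θ ^ 2 := Finset.sum_le_sum fun i _ => by
            rw [← sq_abs]; gcongr; exact hAxz i
      _ = _ := by simp
  have hcone := l1Norm_sub_le_of_l1Norm_le (s := s) hz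
  have hσ : 0 ≤ bestTermError s x :=
    Real.sInf_nonneg (by rintro _ ⟨w, -, rfl⟩; exact l1Norm_nonneg _)
  set σ := bestTermError s x
  set d := l2Norm (x - z) with hd
  have hd0 : 0 ≤ d := l2Norm_nonneg _
  rw [← l2Norm_sq, ← hd] at hlow
  have hs' : (0 : ℝ) < s := by exact_mod_cast hs
  have hm' : (0 : ℝ) < m := by exact_mod_cast hm
  have hsq : √(s : ℝ) ^ 2 = s := Real.sq_sqrt hs'.le
  have hspos : 0 < √(s : ℝ) := Real.sqrt_pos.2 hs'
  have hpow : (s : ℝ) ^ (-(1 / 2) : ℝ) = (√s)⁻¹ := by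
    rw [Real.rpow_neg hs'.le, Real.sqrt_eq_rpow]
  rw [hpow]
  set r := √(s : ℝ)
  have hl1 : l1Norm (x - z) ^ 2 ≤ 8 * r ^ 2 * d ^ 2 + 8 * σ ^ 2 := by
    calc _ ≤ (2 * r * d + 2 * σ) ^ 2 := by gcongr; exact l1Norm_nonneg _
      _ ≤ _ := by nlinarith [sq_nonneg (2 * r * d - 2 * σ)]
  have hτ : 0 ≤ r⁻¹ * σ := by positivity
  set τ := r⁻¹ * σ with hτd
  have hστ : σ = r * τ := by rw [hτd]; field_simp
  -- The value 512 comes from `4 * 8 / 512 = 1 / 16`, half of the coefficient `1 / 8` in the lower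
  -- bound.
  have herr : 4 * m * l1Norm (x - z) ^ 2 / (512 * s : ℕ) ≤ m * (d ^ 2 + τ ^ 2) / 16 := by
    push_cast
    rw [div_le_iff₀ (by positivity), ← hsq]
    rw [hστ] at hl1
    nlinarith
  have hkey : d ^ 2 ≤ 16 * θ ^ 2 + τ ^ 2 := by
    have : m * (d ^ 2) ≤ m * (16 * θ ^ 2 + τ ^ 2) := by nlinarith
    exact le_of_mul_le_mul_left this hm'
  refine le_of_sq_le_sq ?_ (by positivity)
  nlinarith [mul_nonneg hτ hθ.le]

/-! ### Gaussian concentration for a fixed vector -/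

section Gaussian

variable {Ω : Type*} [MeasurableSpace Ω] {μ : Measure Ω}

/-- A linear combination of independent standard Gaussians is Gaussian. -/
theorem hasLaw_sum_mul_gaussianReal {κ : Type*} [Fintype κ] {Y : κ → Ω → ℝ}
    (hY : ∀ k, HasLaw (Y k) (gaussianReal 0 1) μ) (hind : iIndepFun Y μ) (c : κ → ℝ) :
    HasLaw (fun ω => ∑ k, c k * Y k ω) (gaussianReal 0 (∑ k, c k ^ 2).toNNReal) μ := by
  have := hind.isProbabilityMeasure
  have hlaw : ∀ k, HasLaw (fun ω => c k * Y k ω) (gaussianReal 0 (c k ^ 2).toNNReal) μ :=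
    fun k => by
      have h := gaussianReal_const_mul (hY k) (c k)
      simpa [Real.toNNReal_of_nonneg (sq_nonneg (c k))] using h
  have hind' : iIndepFun (fun k ω => c k * Y k ω) μ :=
    hind.comp (fun k y => c k * y) fun k => measurable_const_mul (c k)
  have hm : AEMeasurable (fun ω => ∑ k, c k * Y k ω) μ :=
    Finset.aemeasurable_fun_sum _ fun k _ => (hlaw k).aemeasurable
  refine ⟨hm, ?_⟩
  have := Measure.isProbabilityMeasure_map hm
  refine Measure.ext_of_charFun ?_
  rw [hind'.charFun_map_fun_sum_eq_prod fun k => (hlaw k).aemeasurable]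
  ext t
  simp only [Finset.prod_apply, (hlaw _).map_eq, charFun_gaussianReal, ← Complex.exp_sum,
    Real.coe_toNNReal _ (sq_nonneg _),
    Real.coe_toNNReal _ (Finset.sum_nonneg fun k _ => sq_nonneg (c k))]
  congr 1
  simp [Finset.sum_mul, Finset.sum_div]

theorem IsStandardGaussianMatrix.hasLaw_mulVec {m n : ℕ} {A : Ω → Matrix (Fin m) (Fin n) ℝ}
    (hA : IsStandardGaussianMatrix μ A) {w : Fin n → ℝ} (hw : ∑ j, w j ^ 2 = 1) (i : Fin m) :
    HasLaw (fun ω => (A ω).mulVec w i) (gaussianReal 0 1) μ := by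
  have h := hasLaw_sum_mul_gaussianReal (hA.hasLaw i)
    (hA.indep.precomp (g := fun j => (i, j)) (Prod.mk_right_injective i)) w
  simpa [hw, Matrix.mulVec, dotProduct, mul_comm] using h

/-- The joint characteristic function factors: `⟨A w, t⟩` is a Gaussian combination of the entries
with coefficients `t i * w j`, so its variance is `∑ i, t i ^ 2`. -/
theorem IsStandardGaussianMatrix.iIndepFun_mulVec {m n : ℕ}
    {A : Ω → Matrix (Fin m) (Fin n) ℝ} (hA : IsStandardGaussianMatrix μ A)
    {w : Fin n → ℝ} (hw : ∑ j, w j ^ 2 = 1) :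
    iIndepFun (fun (i : Fin m) ω => (A ω).mulVec w i) μ := by
  have := hA.indep.isProbabilityMeasure
  have hm := fun i => (hA.hasLaw_mulVec hw i).aemeasurable
  rw [iIndepFun_iff_charFun_pi hm]
  intro t
  have hsum := hasLaw_sum_mul_gaussianReal (fun ij : Fin m × Fin n => hA.hasLaw ij.1 ij.2)
    hA.indep (fun ij => t ij.1 * w ij.2)
  have hvar : ∑ ij : Fin m × Fin n, (t ij.1 * w ij.2) ^ 2 = ∑ i, t i ^ 2 := by
    simp_rw [mul_pow, Fintype.sum_prod_type, ← Finset.mul_sum, hw, mul_one]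
  have hfun : ∀ ω, ∑ ij : Fin m × Fin n, t ij.1 * w ij.2 * A ω ij.1 ij.2
      = inner ℝ (WithLp.toLp 2 fun i => (A ω).mulVec w i) t := fun ω => by
    simp only [Fintype.sum_prod_type, PiLp.inner_apply, Matrix.mulVec, dotProduct]
    refine Finset.sum_congr rfl fun i _ => ?_
    simp only [RCLike.inner_apply, conj_trivial, Finset.mul_sum]
    exact Finset.sum_congr rfl fun j _ => by ring
  have hL : AEMeasurable (fun ω => WithLp.toLp 2 fun i => (A ω).mulVec w i) μ := by fun_prop
  have h1 : charFun (μ.map fun ω => WithLp.toLp 2 fun i => (A ω).mulVec w i) t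
      = charFun (μ.map fun ω => ∑ ij : Fin m × Fin n, t ij.1 * w ij.2 * A ω ij.1 ij.2) 1 := by
    rw [charFun_apply, charFun_apply, integral_map hL (by fun_prop),
      integral_map hsum.aemeasurable (by fun_prop)]
    simp [hfun]
  rw [h1, hsum.map_eq, hvar]
  simp only [(hA.hasLaw_mulVec hw _).map_eq, charFun_gaussianReal, ← Complex.exp_sum,
    Real.coe_toNNReal _ (Finset.sum_nonneg fun k _ => sq_nonneg (t k))]
  congr 1
  simp [Finset.sum_div]

/-- For `t ≥ 1 / 2` the integral diverges and both sides take the default value 0. -/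
theorem integral_exp_mul_sq_gaussianReal {t : ℝ} :
    ∫ x, Real.exp (t * x ^ 2) ∂gaussianReal 0 1 = (√(1 - 2 * t))⁻¹ := by
  rw [integral_gaussianReal_eq_integral_smul one_ne_zero]
  have h : ∀ x : ℝ, gaussianPDFReal 0 1 x • Real.exp (t * x ^ 2)
      = (√(2 * Real.pi))⁻¹ * Real.exp (-(1 / 2 - t) * x ^ 2) := fun x => by
    simp only [gaussianPDFReal, smul_eq_mul, NNReal.coe_one, mul_one, sub_zero, mul_assoc,
      ← Real.exp_add]
    ring_nf
  simp_rw [h]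
  rw [integral_const_mul, integral_gaussian, ← Real.sqrt_inv, ← Real.sqrt_inv,
    ← Real.sqrt_mul (by positivity)]
  congr 1
  have := Real.pi_pos.ne'
  rw [show (1 / 2 - t : ℝ) = (1 - 2 * t) / 2 by ring]
  field_simp

theorem mgf_sq_eq {X : Ω → ℝ} (hX : HasLaw X (gaussianReal 0 1) μ) (t : ℝ) :
    mgf (fun ω => X ω ^ 2) μ t = (√(1 - 2 * t))⁻¹ := by
  rw [← integral_exp_mul_sq_gaussianReal, mgf,
    ← hX.integral_comp (f := fun x => Real.exp (t * x ^ 2)) (by fun_prop)]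
  rfl

theorem mgf_sum_sq_eq {m : ℕ} {X : Fin m → Ω → ℝ}
    (hX : ∀ i, HasLaw (X i) (gaussianReal 0 1) μ) (hind : iIndepFun X μ) (t : ℝ) :
    mgf (∑ i, fun ω => X i ω ^ 2) μ t = (√(1 - 2 * t))⁻¹ ^ m := by
  have hind' : iIndepFun (fun i ω => X i ω ^ 2) μ :=
    hind.comp (fun _ y => y ^ 2) fun _ => measurable_id.pow_const 2
  have hm : ∀ i, AEMeasurable (fun ω => X i ω ^ 2) μ := fun i => (hX i).aemeasurable.pow_const 2
  rw [hind'.mgf_sum₀ hm]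
  simp [mgf_sq_eq (hX _)]

/-- A non-integrable function would have integral 0, but the moment generating function is positive
here. -/
theorem integrable_exp_mul_sum_sq {m : ℕ} {X : Fin m → Ω → ℝ}
    (hX : ∀ i, HasLaw (X i) (gaussianReal 0 1) μ) (hind : iIndepFun X μ) {t : ℝ}
    (ht : t < 1 / 2) : Integrable (fun ω => Real.exp (t * (∑ i, fun ω => X i ω ^ 2) ω)) μ := by
  by_contra h
  have h1 := mgf_sum_sq_eq hX hind t
  rw [mgf, integral_undef h] at h1
  have : 0 < √(1 - 2 * t) := Real.sqrt_pos.2 (by linarith)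
  exact (pow_pos (inv_pos.2 this) m).ne h1

/-- Lower tail of the chi-square distribution. -/
theorem measureReal_sum_sq_le {m : ℕ} {X : Fin m → Ω → ℝ}
    (hX : ∀ i, HasLaw (X i) (gaussianReal 0 1) μ) (hind : iIndepFun X μ) :
    μ.real {ω | ∑ i, X i ω ^ 2 ≤ m / 8} ≤ Real.exp (-(m / 2)) := by
  have := hind.isProbabilityMeasure
  -- Chernoff at `t = -4`, where `√(1 - 2t) = 3 > e`.
  have h := measure_le_le_exp_mul_mgf (μ := μ) (m / 8 : ℝ) (t := -4) (by norm_num)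
    (integrable_exp_mul_sum_sq hX hind (by norm_num))
  rw [mgf_sum_sq_eq hX hind] at h
  simp only [Finset.sum_apply] at h
  refine h.trans ?_
  have h3 : √(1 - 2 * (-4 : ℝ)) = 3 := by
    rw [show (1 - 2 * (-4) : ℝ) = 3 ^ 2 by norm_num]; exact Real.sqrt_sq (by norm_num)
  have he : (3 : ℝ)⁻¹ ≤ Real.exp (-1) := by
    rw [Real.exp_neg]
    gcongr
    exact Real.exp_one_lt_three.le
  calc _ ≤ Real.exp (- -4 * (m / 8)) * Real.exp (-1) ^ m := by rw [h3]; gcongr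
    _ = _ := by rw [← Real.exp_nat_mul, ← Real.exp_add]; ring_nf

/-- Upper tail of the chi-square distribution. -/
theorem measureReal_le_sum_sq {m : ℕ} {X : Fin m → Ω → ℝ}
    (hX : ∀ i, HasLaw (X i) (gaussianReal 0 1) μ) (hind : iIndepFun X μ) :
    μ.real {ω | 4 * (m : ℝ) ≤ ∑ i, X i ω ^ 2} ≤ Real.exp (-(m / 2)) := by
  have := hind.isProbabilityMeasure
  -- Chernoff at `t = 3 / 8`, where each factor is `2 < e`.
  have h := measure_ge_le_exp_mul_mgf (μ := μ) (4 * m : ℝ) (t := 3 / 8) (by norm_num)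
    (integrable_exp_mul_sum_sq hX hind (by norm_num))
  rw [mgf_sum_sq_eq hX hind] at h
  simp only [Finset.sum_apply] at h
  refine h.trans ?_
  have h3 : (√(1 - 2 * (3 / 8 : ℝ)))⁻¹ = 2 := by
    rw [show (1 - 2 * (3 / 8) : ℝ) = 2⁻¹ ^ 2 by norm_num, Real.sqrt_sq (by norm_num), inv_inv]
  have he : (2 : ℝ) ≤ Real.exp 1 := by linarith [Real.add_one_le_exp (1 : ℝ)]
  calc _ ≤ Real.exp (-(3 / 8) * (4 * m)) * Real.exp 1 ^ m := by rw [h3]; gcongr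
    _ = _ := by rw [← Real.exp_nat_mul, ← Real.exp_add]; ring_nf

/-- A Gaussian matrix nearly preserves the norm of a fixed vector with high probability. -/
theorem IsStandardGaussianMatrix.measureReal_not_norm_preserved_le {m n : ℕ}
    {A : Ω → Matrix (Fin m) (Fin n) ℝ} (hA : IsStandardGaussianMatrix μ A) (u : Fin n → ℝ) :
    μ.real {ω | ¬ ((m / 8 : ℝ) * ∑ j, u j ^ 2 ≤ ∑ i, (A ω).mulVec u i ^ 2 ∧
      ∑ i, (A ω).mulVec u i ^ 2 ≤ (4 * m : ℝ) * ∑ j, u j ^ 2)} ≤ 2 * Real.exp (-(m / 2)) := by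
  have := hA.indep.isProbabilityMeasure
  rcases (Finset.sum_nonneg fun j (_ : j ∈ Finset.univ) => sq_nonneg (u j)).eq_or_lt with h0 | h0
  · have hu : u = 0 := by
      ext j
      have := (Finset.sum_eq_zero_iff_of_nonneg (fun j _ => sq_nonneg (u j))).1 h0.symm j
        (Finset.mem_univ j)
      simpa using this
    subst hu
    simp only [Matrix.mulVec_zero]
    simp
    positivity
  set v := ∑ j, u j ^ 2 with hv
  let w : Fin n → ℝ := (√v)⁻¹ • u
  have hw : ∑ j, w j ^ 2 = 1 := by
    simp only [w, Pi.smul_apply, smul_eq_mul, mul_pow, ← Finset.mul_sum, inv_pow,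
      Real.sq_sqrt h0.le, ← hv]
    exact inv_mul_cancel₀ h0.ne'
  have hAw : ∀ ω, ∑ i, (A ω).mulVec u i ^ 2 = v * ∑ i, (A ω).mulVec w i ^ 2 := fun ω => by
    simp only [w, Matrix.mulVec_smul, Pi.smul_apply, smul_eq_mul, mul_pow, ← Finset.mul_sum,
      inv_pow, Real.sq_sqrt h0.le]
    rw [mul_inv_cancel_left₀ h0.ne']
  have hX := hA.hasLaw_mulVec hw
  have hind := hA.iIndepFun_mulVec hw
  calc _ ≤ μ.real ({ω | ∑ i, (A ω).mulVec w i ^ 2 ≤ m / 8} ∪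
        {ω | 4 * (m : ℝ) ≤ ∑ i, (A ω).mulVec w i ^ 2}) := by
        refine measureReal_mono fun ω hω => ?_
        by_contra hcon
        simp only [Set.mem_union, Set.mem_ofPred_eq, not_or, not_le] at hcon
        refine hω ?_
        rw [hAw]
        constructor <;> nlinarith [hcon.1, hcon.2]
    _ ≤ _ := measureReal_union_le _ _
    _ ≤ _ := by
      linarith [measureReal_sum_sq_le hX hind, measureReal_le_sum_sq hX hind]

end Gaussian

/-! ### Counting the integer vectors -/

/-- The multiplicity functions of total multiplicity at most `k`. -/
def boundedMultiplicities (ι : Type*) [Fintype ι] [DecidableEq ι] (k : ℕ) : Finset (ι → ℕ) :=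
  (Fintype.piFinset fun _ => Finset.range (k + 1)).filter fun F => ∑ i, F i ≤ k

theorem mem_boundedMultiplicities {ι : Type*} [Fintype ι] [DecidableEq ι] {k : ℕ} {F : ι → ℕ} :
    F ∈ boundedMultiplicities ι k ↔ ∑ i, F i ≤ k := by
  simp only [boundedMultiplicities, Finset.mem_filter, Fintype.mem_piFinset, Finset.mem_range,
    and_iff_right_iff_imp]
  intro h i
  have := Finset.single_le_sum (fun j _ => Nat.zero_le (F j)) (Finset.mem_univ i)
  omega

/-- Generating function bound: each counted `F` contributes at least `t ^ k` to a product of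
geometric sums, each at most `1 + 2t`. -/
theorem card_boundedMultiplicities_mul_pow_le (ι : Type*) [Fintype ι] [DecidableEq ι] (k : ℕ)
    {t : ℝ} (ht : 0 ≤ t) (ht2 : t ≤ 1 / 2) :
    ((boundedMultiplicities ι k).card : ℝ) * t ^ k ≤ Real.exp (2 * t * Fintype.card ι) := by
  have hgeom : ∑ j ∈ Finset.range (k + 1), t ^ j ≤ Real.exp (2 * t) := by
    have h1 : (∑ j ∈ Finset.range (k + 1), t ^ j) * (1 - t) = 1 - t ^ (k + 1) := geom_sum_mul_neg t _
    have h2 : 0 ≤ t ^ (k + 1) := by positivity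
    have h3 : ∑ j ∈ Finset.range (k + 1), t ^ j ≤ 1 + 2 * t := by
      by_contra! hc
      nlinarith
    linarith [Real.add_one_le_exp (2 * t)]
  calc _ = ∑ F ∈ boundedMultiplicities ι k, t ^ k := by simp
    _ ≤ ∑ F ∈ boundedMultiplicities ι k, ∏ i, t ^ F i := Finset.sum_le_sum fun F hF => by
      rw [Finset.prod_pow_eq_pow_sum]
      exact pow_le_pow_of_le_one ht (by linarith) (mem_boundedMultiplicities.1 hF)
    _ ≤ ∑ F ∈ Fintype.piFinset fun _ : ι => Finset.range (k + 1), ∏ i, t ^ F i :=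
      Finset.sum_le_sum_of_subset_of_nonneg (Finset.filter_subset _ _) fun F _ _ => by positivity
    _ = ∏ _i : ι, ∑ j ∈ Finset.range (k + 1), t ^ j := (Finset.prod_univ_sum _ _).symm
    _ ≤ ∏ _i : ι, Real.exp (2 * t) := Finset.prod_le_prod (fun _ _ => by positivity) fun _ _ => hgeom
    _ = _ := by rw [Finset.prod_const, ← Real.exp_nat_mul, Finset.card_univ, mul_comm]

theorem card_boundedMultiplicities_le {n s : ℕ} (hs : 1 ≤ s) (hsn : s ≤ n) :
    ((boundedMultiplicities (Fin n × Bool) (512 * s + 1)).card : ℝ) ≤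
      Real.exp (515 * (s * Real.log (Real.exp 1 * n / s))) := by
  have hs' : (1 : ℝ) ≤ s := by exact_mod_cast hs
  have hsn' : (s : ℝ) ≤ n := by exact_mod_cast hsn
  have hs0 : (0 : ℝ) < s := by linarith
  have hn0 : (0 : ℝ) < n := by linarith
  -- This `t` makes the exponential factor `exp (2s)`, while `t⁻¹ = 2n/s ≤ e n/s`.
  have h := card_boundedMultiplicities_mul_pow_le (Fin n × Bool) (512 * s + 1)
    (t := s / (2 * n)) (by positivity) (by rw [div_le_iff₀ (by positivity)]; linarith)
  rw [← le_div_iff₀ (by positivity)] at h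
  refine h.trans ?_
  set l := Real.log (Real.exp 1 * n / s) with hl
  have hl1 : 1 ≤ l := by
    rw [hl, Real.le_log_iff_exp_le (by positivity), le_div_iff₀ hs0]
    gcongr
  have hlog : ((s : ℝ) / (2 * n))⁻¹ ≤ Real.exp l := by
    rw [hl, Real.exp_log (by positivity), inv_div]
    gcongr
    linarith [Real.add_one_le_exp (1 : ℝ)]
  rw [div_eq_mul_inv, ← inv_pow]
  calc _ ≤ Real.exp (2 * (s / (2 * n)) * (Fintype.card (Fin n × Bool) : ℕ)) *
        Real.exp l ^ (512 * s + 1) := by gcongr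
    _ = Real.exp (2 * s + (512 * s + 1) * l) := by
      rw [← Real.exp_nat_mul, ← Real.exp_add]
      congr 1
      simp only [Fintype.card_prod, Fintype.card_fin, Fintype.card_bool]
      push_cast
      field_simp
    _ ≤ _ := by
      refine Real.exp_le_exp.2 ?_
      nlinarith

end QuantizedCS

/-! ### Union bound and conclusion -/

theorem corollary4p1 :
    ∃ C : ℝ, 0 < C ∧ ∃ c : ℝ, 0 < c ∧
      ∀ (m n s : ℕ), 1 ≤ s → s ≤ n →
      ∀ (η : ℝ), 0 < η → η < 1 →
      (m : ℝ) ≥ C * ((s : ℝ) * Real.log (Real.exp 1 * (n : ℝ) / (s : ℝ)) + Real.log η⁻¹) →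
      ∀ (θ : ℝ), 0 < θ →
      ∀ (Ω : Type*) [MeasurableSpace Ω] (μ : Measure Ω) [IsProbabilityMeasure μ]
        (A : Ω → Matrix (Fin m) (Fin n) ℝ), QuantizedCS.IsStandardGaussianMatrix μ A →
      ∃ E : Set Ω, MeasurableSet E ∧ 1 - η < μ.real E ∧
        ∀ ω ∈ E, ∀ (xhat : Fin n → ℝ) (y : Fin m → ℝ),
          y = QuantizedCS.quantizer θ ((A ω).mulVec xhat) →
          ∀ xsharp : Fin n → ℝ, QuantizedCS.IsQCBPSolution (A ω) θ y xsharp →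
            QuantizedCS.IsQuantizationConsistent (A ω) θ y xsharp ∧
            QuantizedCS.l2Norm (xhat - xsharp) ≤
              c * ((s : ℝ) ^ (-(1 / 2) : ℝ) * QuantizedCS.bestTermError s xhat + θ) := by
  -- `1040 = 2 * 520`: half of `m` must beat `515 * ℓ + 1 + log η⁻¹`, where `ℓ ≥ 1`.
  refine ⟨1040, by norm_num, 4, by norm_num, ?_⟩
  intro m n s hs hsn η hη hη1 hm θ hθ Ω _ μ _ A hA
  set ℓ := (s : ℝ) * Real.log (Real.exp 1 * n / s) with hℓ
  have hs' : (1 : ℝ) ≤ s := by exact_mod_cast hs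
  have hsn' : (s : ℝ) ≤ n := by exact_mod_cast hsn
  have hn0 : (0 : ℝ) < n := by linarith
  have hℓ1 : 1 ≤ ℓ := by
    have : 1 ≤ Real.log (Real.exp 1 * n / s) := by
      rw [Real.le_log_iff_exp_le (by positivity), le_div_iff₀ (by linarith)]
      gcongr
    nlinarith
  have hη' : 0 < Real.log η⁻¹ := Real.log_pos ((one_lt_inv₀ hη).2 hη1)
  have hm0 : 0 < m := by
    have : (0 : ℝ) < m := by nlinarith
    exact_mod_cast this
  let S := QuantizedCS.boundedMultiplicities (Fin n × Bool) (512 * s + 1)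
  let bad : (Fin n × Bool → ℕ) → Set Ω := fun F =>
    {ω | ¬ ((m / 8 : ℝ) * ∑ j, QuantizedCS.signedCount F j ^ 2 ≤
        ∑ i, (A ω).mulVec (QuantizedCS.signedCount F) i ^ 2 ∧
      ∑ i, (A ω).mulVec (QuantizedCS.signedCount F) i ^ 2 ≤
        (4 * m : ℝ) * ∑ j, QuantizedCS.signedCount F j ^ 2)}
  have hbad : μ.real (⋃ F ∈ S, bad F) < η := by
    calc μ.real (⋃ F ∈ S, bad F) ≤ ∑ F ∈ S, μ.real (bad F) := measureReal_biUnion_finset_le _ _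
      _ ≤ ∑ _F ∈ S, 2 * Real.exp (-(m / 2)) :=
        Finset.sum_le_sum fun F _ => hA.measureReal_not_norm_preserved_le _
      _ = S.card * (2 * Real.exp (-(m / 2))) := by simp
      _ ≤ Real.exp (515 * ℓ) * (Real.exp 1 * Real.exp (-(m / 2))) := by
        gcongr
        · exact QuantizedCS.card_boundedMultiplicities_le hs hsn
        · linarith [Real.add_one_le_exp (1 : ℝ)]
      _ = Real.exp (515 * ℓ + 1 - m / 2) := by
        rw [← Real.exp_add, ← Real.exp_add]
        ring_nf
      _ < Real.exp (-Real.log η⁻¹) := by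
        refine Real.exp_lt_exp.2 ?_
        linarith
      _ = η := by rw [Real.log_inv, neg_neg, Real.exp_log hη]
  -- The entries are only a.e. measurable, so the bad event is replaced by a measurable hull of
  -- equal measure.
  refine ⟨(toMeasurable μ (⋃ F ∈ S, bad F))ᶜ, (measurableSet_toMeasurable _ _).compl, ?_, ?_⟩
  · rw [probReal_compl_eq_one_sub (measurableSet_toMeasurable _ _), Measure.real,
      measure_toMeasurable]
    exact sub_lt_sub_left hbad 1
  rintro ω hω x y rfl z hz
  have hgood : ω ∉ ⋃ F ∈ S, bad F := fun h => hω (subset_toMeasurable _ _ h)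
  have hx := QuantizedCS.self_mem_feasible (A ω) hθ x
  refine ⟨QuantizedCS.quantizationConsistent_of_mem_feasible hθ hz.1,
    QuantizedCS.l2Norm_sub_le hm0 hs (fun F hF => ?_) hθ (hz.2 x hx) fun i =>
      QuantizedCS.abs_mulVec_sub_le_of_feasible hx hz.1 i⟩
  by_contra hF'
  exact hgood (Set.mem_biUnion (QuantizedCS.mem_boundedMultiplicities.2 hF) hF')
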